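/- Consider the Kepler problem $\ddot q=-q/\|q\|^3$ in the Euclidean plane ${\rm O}xy$. A Keplerian arc is a solution $q$, avoiding the center ${\rm O}$, restricted to a time interval $[t_{\rm A},t_{\rm B}]$ with $t_{\rm A}<t_{\rm B}$; its elapsed time is $t_{\rm B}-t_{\rm A}$ and its energy is $H=\|\dot q\|^2/2-1/\|q\|$. It is direct if the convex hull of its image does not contain ${\rm O}$. It has signed eccentricity $\eta$ (with respect to the axis ${\rm O}y$) if it lies on the conic of polar equation $r=C^2/(1-\eta\sin\theta)$, where $C=x\dot y-y\dot x\neq 0$ is the angular momentum. Let ${\rm A}\ne{\rm B}$ be two points of the plane which are symmetric with respect to ${\rm O}y$ and have positive ordinate $y_{\rm A}$, put $r_{\rm A}=\|{\rm OA}\|$, let $0<x_{\rm B}<x_{\rm A}$, and assume that the isosceles triangle ${\rm AOB}$ and the flat triangle with vertices ${\rm O}$, $(x_{\rm A},0)$, $(x_{\rm B},0)$ satisfy $$\|{\rm AB}\|=x_{\rm A}-x_{\rm B},\qquad \|{\rm OA}\|+\|{\rm OB}\|=x_{\rm A}+x_{\rm B}.$$ Let $v_E=\sqrt{2/x_{\rm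 A}}$. Then (1) the function $$v_{\rm A}(\eta)=\frac{\eta-\sqrt{x_{\rm B}/x_{\rm A}}}{\sqrt{(x_{\rm A}+x_{\rm B})/2-\eta\sqrt{x_{\rm A}x_{\rm B}}}}$$ is a bijection from $]-\infty,1[$ onto $]-\infty,v_E[$, and it is smooth with positive derivative; (2) for every $\eta<1$ there is a direct arc from ${\rm A}$ to ${\rm B}$ with signed eccentricity $\eta$ (the direct symmetric arc), and all such arcs have the same elapsed time $T_D^S(\eta)$ and the same energy $H^S(\eta)=\dfrac{\eta^2-1}{2(r_{\rm A}-\eta y_{\rm A})}$; (3) for every $v<v_E$ there is a direct rectilinear arc (one that remains on a ray from ${\rm O}$) from $(x_{\rm A},0)$ to $(x_{\rm B},0)$ with initial velocity $(v,0)$, and all such arcs have the same elapsed time $T_D^R(v)$ and the same energy $H^R(v)=\dfrac{v^2}{2}-\dfrac1{x_{\rm A}}$; (4) for every $\eta<1$, $\;T_D^S(\eta)=T_D^R(v_{\rm A}(\eta))$ and $H^S(\eta)=H^R(v_{\rm A}(\eta))$. -/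

import Mathlib

open scoped ContDiff

/-- A Keplerian arc around the center `O = 0` in the Euclidean plane `Oxy`, which is identified with
`ℂ` by `x + i y`: a solution `q = pos` of Newton's equation `q'' = -q / ‖q‖ ^ 3`, with velocity
`q' = vel`, on a bounded closed interval of time `[tA, tB]` with `tA < tB`. -/
structure KeplerArc where
  tA : ℝ
  tB : ℝ
  tA_lt_tB : tA < tB
  pos : ℝ → ℂ
  vel : ℝ → ℂ
  pos_ne_zero : ∀ t ∈ Set.Icc tA tB, pos t ≠ 0
  hasDeriv_pos : ∀ t ∈ Set.Icc tA tB, HasDerivWithinAt pos (vel t) (Set.Icc tA tB) t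
  hasDeriv_vel : ∀ t ∈ Set.Icc tA tB,
    HasDerivWithinAt vel (-(pos t) / ((‖pos t‖ ^ 3 : ℝ) : ℂ)) (Set.Icc tA tB) t

namespace KeplerArc

/-- The arc goes from the initial point `A` to the final point `B`. -/
def Joins (a : KeplerArc) (A B : ℂ) : Prop :=
  a.pos a.tA = A ∧ a.pos a.tB = B

/-- An arc is direct if its convex hull does not contain the center. -/
def IsDirect (a : KeplerArc) : Prop :=
  (0 : ℂ) ∉ convexHull ℝ (a.pos '' Set.Icc a.tA a.tB)

/-- An arc is rectilinear if the body remains on the same ray drawn from the center. -/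
def IsRectilinear (a : KeplerArc) : Prop :=
  ∃ u : ℂ, u ≠ 0 ∧ ∀ t ∈ Set.Icc a.tA a.tB, ∃ s : ℝ, 0 ≤ s ∧ a.pos t = (s : ℂ) * u

/-- The elapsed time. -/
def elapsedTime (a : KeplerArc) : ℝ := a.tB - a.tA

/-- The energy `‖q'‖ ^ 2 / 2 - 1 / ‖q‖` is equal to `H` all along the arc. -/
def HasEnergy (a : KeplerArc) (H : ℝ) : Prop :=
  ∀ t ∈ Set.Icc a.tA a.tB, ‖a.vel t‖ ^ 2 / 2 - 1 / ‖a.pos t‖ = H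

/-- The angular momentum `C = x y' - y x'` at time `t`. -/
def angularMomentum (a : KeplerArc) (t : ℝ) : ℝ :=
  (a.pos t).re * (a.vel t).im - (a.pos t).im * (a.vel t).re

/-- The arc is part of the conic with principal axis `Oy`, signed eccentricity `η` and
semi-parameter `C ^ 2 > 0`, whose polar equation is `r = C ^ 2 / (1 - η sin θ)`, that is,
`r - η y = C ^ 2`. -/
def HasSignedEccentricity (a : KeplerArc) (η : ℝ) : Prop :=
  ∀ t ∈ Set.Icc a.tA a.tB, a.angularMomentum t ≠ 0 ∧
    ‖a.pos t‖ - η * (a.pos t).im = a.angularMomentum t ^ 2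

/-- The direct symmetric arc from `A` to `B` (two points that are symmetric with respect to `Oy`)
with signed eccentricity `η`. -/
def IsDirectSymmetric (A B : ℂ) (η : ℝ) (a : KeplerArc) : Prop :=
  a.Joins A B ∧ a.IsDirect ∧ a.HasSignedEccentricity η

/-- The direct rectilinear arc on the line `Ox` from abscissa `xA` to abscissa `xB`, with initial
velocity `vA`. -/
def IsDirectRectilinear (xA xB vA : ℝ) (a : KeplerArc) : Prop :=
  a.Joins (xA : ℂ) (xB : ℂ) ∧ a.IsDirect ∧ a.IsRectilinear ∧ a.vel a.tA = (vA : ℂ)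

end KeplerArc

/-- `T` and `H` are the elapsed time and the energy of the arc characterized by `P`: there is such
an arc, and every such arc has elapsed time `T` and energy `H`. -/
def AreTimeAndEnergy (P : KeplerArc → Prop) (T H : ℝ) : Prop :=
  (∃ a, P a) ∧ ∀ a, P a → a.elapsedTime = T ∧ a.HasEnergy H

/-- The change of variable `η ↦ v_A(η)`. -/
noncomputable def changeOfVariable (xA xB η : ℝ) : ℝ :=
  (η - √(xB / xA)) / √((xA + xB) / 2 - η * √(xA * xB))

/-! On the conic `r = C² + η y`, put `X = r + σ x`, where `σ` is the common sign of `A.re` and `C`,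
and introduce a new time `τ` with `dτ/dt = X / r`. The explicit velocity on a conic gives `dX/dτ =
W` with `W = σ (η - y / X) / C`, and then `dW/dτ = -1 / X²`: in the time `τ`, `X` is a rectilinear
Keplerian motion. Since `y' = x / (C r)`, one may take `τ = t + σ C y`, and the equality of the two
end ordinates makes the elapsed times agree. The end values `‖A‖ ± |A.re|` are `xA` and `xB`, and
the initial value of `W` is `v_A(η)`, because `C² = ‖A‖ - η A.im` and `A.im² = xA xB`. This is
`IsDirectSymmetric.exists_isDirectRectilinear`.

Directness enters through `IsDirect.im_pos`: the arc stays in `y > 0`, so that `|x| < r` and `X >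
0`, and the sign of `C` is determined.

The arc on the conic is built explicitly in `exists_isDirectSymmetric`. Rectilinear arcs need no
separate construction: `v_A` is onto (`bijOn_changeOfVariable`), so each of them is the transform of
a symmetric arc. Their elapsed time is well defined by uniqueness for the Cauchy problem and
concavity of the motion (`IsDirectRectilinear.elapsedTime_eq`), which also fixes the elapsed time of
all symmetric arcs. -/

/-! ### Preliminaries: compact convex hulls and reparametrization -/

/-- The convex hull of a compact set of a finite-dimensional space is compact. -/
theorem IsCompact.convexHull_of_finiteDimensional {E : Type*} [NormedAddCommGroup E]
    [NormedSpace ℝ E] [FiniteDimensional ℝ E] {s : Set E} (hs : IsCompact s) :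
    IsCompact (convexHull ℝ s) := by
  rcases s.eq_empty_or_nonempty with rfl | ⟨x₀, hx₀⟩
  · simp
  -- By Carathéodory's theorem `N` points always suffice, so the hull is the continuous image of a
  -- simplex times `s ^ N`.
  set N := Module.finrank ℝ E + 1
  let Φ : (Fin N → ℝ) × (Fin N → E) → E := fun p => ∑ i, p.1 i • p.2 i
  have hΦ : Continuous Φ := by fun_prop
  have hK : IsCompact (stdSimplex ℝ (Fin N) ×ˢ Set.univ.pi fun _ : Fin N => s) :=
    (isCompact_stdSimplex ℝ (Fin N)).prod (isCompact_univ_pi fun _ => hs)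
  convert hK.image hΦ using 1
  apply Set.Subset.antisymm
  · intro x hx
    obtain ⟨ι, hι, z, w, hz, hai, hw, hw1, rfl⟩ := eq_pos_convex_span_of_mem_convexHull hx
    have hcard : Fintype.card ι ≤ Fintype.card (Fin N) := by
      have := hai.card_le_finrank_succ
      have h2 := Submodule.finrank_le (vectorSpan ℝ (Set.range z))
      simp only [Fintype.card_fin, N]
      omega
    obtain ⟨e⟩ := Function.Embedding.nonempty_of_card_le hcard
    have hext : ∀ i ∉ Set.range e, Function.extend e w 0 i = 0 := fun i hi => by
      rw [Function.extend_apply' _ _ _ hi]; rfl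
    -- Combinations of fewer than `N` points are padded with weight `0` at the arbitrary point `x₀`
    -- of `s`.
    refine ⟨(Function.extend e w 0, Function.extend e z fun _ => x₀), ⟨⟨fun i => ?_, ?_⟩, ?_⟩, ?_⟩
    · by_cases hi : i ∈ Set.range e
      · obtain ⟨j, rfl⟩ := hi
        simpa [e.injective.extend_apply] using (hw j).le
      · exact (hext i hi).ge
    · rw [← hw1]
      exact (Fintype.sum_of_injective e e.injective _ _ hext
        fun i => (e.injective.extend_apply _ _ _).symm).symm
    · intro i _
      by_cases hi : i ∈ Set.range e
      · obtain ⟨j, rfl⟩ := hi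
        simpa [e.injective.extend_apply] using hz ⟨j, rfl⟩
      · simpa [Function.extend_apply' _ _ _ hi] using hx₀
    · refine (Fintype.sum_of_injective e e.injective _ _ (fun i hi => ?_) fun i => ?_).symm
      · simp [hext i hi]
      · simp [e.injective.extend_apply]
  · rintro _ ⟨p, ⟨⟨h0, h1⟩, h2⟩, rfl⟩
    exact (convex_convexHull ℝ s).sum_mem (fun i _ => h0 i) h1
      fun i hi => subset_convexHull ℝ s (h2 i (Set.mem_univ i))

/-- A differentiable function with positive continuous derivative on a segment has a differentiable
inverse. -/
theorem exists_inverse_of_hasDerivWithinAt_pos {f f' : ℝ → ℝ} {a b : ℝ} (hab : a < b)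
    (hf : ∀ t ∈ Set.Icc a b, HasDerivWithinAt f (f' t) (Set.Icc a b) t)
    (hf' : ∀ t ∈ Set.Icc a b, 0 < f' t) :
    f a < f b ∧ ∃ g : ℝ → ℝ, g (f a) = a ∧ g (f b) = b ∧
      ∀ s ∈ Set.Icc (f a) (f b), g s ∈ Set.Icc a b ∧
        HasDerivWithinAt g (f' (g s))⁻¹ (Set.Icc (f a) (f b)) s := by
  have hcont : ContinuousOn f (Set.Icc a b) := fun t ht => (hf t ht).continuousWithinAt
  have hmono : StrictMonoOn f (Set.Icc a b) :=
    strictMonoOn_of_hasDerivWithinAt_pos (convex_Icc a b) hcont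
      (fun t ht => (hf t (interior_subset ht)).mono interior_subset)
      fun t ht => hf' t (interior_subset ht)
  have ha : a ∈ Set.Icc a b := Set.left_mem_Icc.2 hab.le
  have hb : b ∈ Set.Icc a b := Set.right_mem_Icc.2 hab.le
  set g := Function.invFunOn f (Set.Icc a b) with hg
  have hleft : ∀ t ∈ Set.Icc a b, g (f t) = t := fun t ht =>
    hmono.injOn.leftInvOn_invFunOn ht
  have hsurj : Set.SurjOn f (Set.Icc a b) (Set.Icc (f a) (f b)) :=
    hcont.surjOn_Icc ha hb
  have hmem : Set.MapsTo g (Set.Icc (f a) (f b)) (Set.Icc a b) := hsurj.mapsTo_invFunOn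
  have hright : ∀ s ∈ Set.Icc (f a) (f b), f (g s) = s := fun s hs =>
    hsurj.rightInvOn_invFunOn hs
  have gmono : MonotoneOn g (Set.Icc (f a) (f b)) := fun s hs t ht hst => by
    rw [← hmono.le_iff_le (hmem hs) (hmem ht), hright s hs, hright t ht]
    exact hst
  have hmaps : Set.MapsTo f (Set.Icc a b) (Set.Icc (f a) (f b)) := fun t ht =>
    ⟨hmono.monotoneOn ha ht ht.1, hmono.monotoneOn ht hb ht.2⟩
  have gcont : ContinuousOn g (Set.Icc (f a) (f b)) := by
    have himg : Set.SurjOn g (Set.Icc (f a) (f b)) (Set.Icc a b) := fun t ht =>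
      ⟨f t, hmaps ht, hleft t ht⟩
    -- A monotone surjection between intervals has no jump, hence is continuous.
    have hrmono : Monotone hmem.restrict := fun s t hst => gmono s.2 t.2 hst
    have hrsurj : Function.Surjective hmem.restrict := fun t =>
      let ⟨s, hs, hst⟩ := himg t.2
      ⟨⟨s, hs⟩, Subtype.ext hst⟩
    rw [continuousOn_iff_continuous_domRestrict]
    exact continuous_subtype_val.comp (hrmono.continuous_of_surjective hrsurj)
  refine ⟨hmono ha hb hab, g, hleft a ha, hleft b hb, fun s hs => ⟨hmem hs, ?_⟩⟩
  have key := HasFDerivWithinAt.of_local_left_inverse (f := f) (g := g) (t := Set.Icc a b)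
    (s := Set.Icc (f a) (f b)) (a := s)
    (f' := (ContinuousLinearEquiv.unitsEquivAut ℝ (Units.mk0 (f' (g s)) (hf' _ (hmem hs)).ne')))
    ((gcont s hs).tendsto_nhdsWithin hmem) (hf _ (hmem hs)) hs
    (eventually_nhdsWithin_of_forall hright)
  exact key

/-! ### Conservation laws and the geometry of direct arcs -/

namespace KeplerArc

variable (a : KeplerArc)

theorem left_mem : a.tA ∈ Set.Icc a.tA a.tB := Set.left_mem_Icc.2 a.tA_lt_tB.le

theorem right_mem : a.tB ∈ Set.Icc a.tA a.tB := Set.right_mem_Icc.2 a.tA_lt_tB.le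

variable {a} {t : ℝ}

theorem uniqueDiff (ht : t ∈ Set.Icc a.tA a.tB) :
    UniqueDiffWithinAt ℝ (Set.Icc a.tA a.tB) t :=
  uniqueDiffOn_Icc a.tA_lt_tB t ht

theorem hasDeriv_re (ht : t ∈ Set.Icc a.tA a.tB) :
    HasDerivWithinAt (fun t => (a.pos t).re) (a.vel t).re (Set.Icc a.tA a.tB) t :=
  Complex.reCLM.hasFDerivAt.comp_hasDerivWithinAt t (a.hasDeriv_pos t ht)

theorem hasDeriv_im (ht : t ∈ Set.Icc a.tA a.tB) :
    HasDerivWithinAt (fun t => (a.pos t).im) (a.vel t).im (Set.Icc a.tA a.tB) t :=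
  Complex.imCLM.hasFDerivAt.comp_hasDerivWithinAt t (a.hasDeriv_pos t ht)

theorem hasDeriv_vel_re (ht : t ∈ Set.Icc a.tA a.tB) :
    HasDerivWithinAt (fun t => (a.vel t).re) (-(a.pos t).re / ‖a.pos t‖ ^ 3)
      (Set.Icc a.tA a.tB) t := by
  have := Complex.reCLM.hasFDerivAt.comp_hasDerivWithinAt t (a.hasDeriv_vel t ht)
  exact this.congr_deriv (by
    rw [Complex.reCLM_apply, Complex.div_ofReal_re, Complex.neg_re])

theorem hasDeriv_vel_im (ht : t ∈ Set.Icc a.tA a.tB) :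
    HasDerivWithinAt (fun t => (a.vel t).im) (-(a.pos t).im / ‖a.pos t‖ ^ 3)
      (Set.Icc a.tA a.tB) t := by
  have := Complex.imCLM.hasFDerivAt.comp_hasDerivWithinAt t (a.hasDeriv_vel t ht)
  exact this.congr_deriv (by
    rw [Complex.imCLM_apply, Complex.div_ofReal_im, Complex.neg_im])

theorem norm_pos (ht : t ∈ Set.Icc a.tA a.tB) : 0 < ‖a.pos t‖ :=
  norm_pos_iff.2 (a.pos_ne_zero t ht)

theorem eq_of_hasDerivWithinAt_zero {f : ℝ → ℝ}
    (hf : ∀ t ∈ Set.Icc a.tA a.tB, HasDerivWithinAt f 0 (Set.Icc a.tA a.tB) t)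
    (ht : t ∈ Set.Icc a.tA a.tB) : f t = f a.tA :=
  constant_of_derivWithin_zero (fun t ht => (hf t ht).differentiableWithinAt)
    (fun t ht => (hf t ⟨ht.1, ht.2.le⟩).derivWithin (uniqueDiff ⟨ht.1, ht.2.le⟩)) t ht

/-- The angular momentum is conserved. -/
theorem angularMomentum_eq (ht : t ∈ Set.Icc a.tA a.tB) :
    a.angularMomentum t = a.angularMomentum a.tA := by
  refine eq_of_hasDerivWithinAt_zero (f := a.angularMomentum) (fun t ht => ?_) ht
  have h := ((hasDeriv_re ht).mul (hasDeriv_vel_im ht)).sub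
    ((hasDeriv_im ht).mul (hasDeriv_vel_re ht))
  refine h.congr_deriv ?_
  ring

/-- The energy is conserved. -/
theorem hasEnergy : a.HasEnergy (‖a.vel a.tA‖ ^ 2 / 2 - 1 / ‖a.pos a.tA‖) := by
  intro t ht
  refine eq_of_hasDerivWithinAt_zero (f := fun t => ‖a.vel t‖ ^ 2 / 2 - 1 / ‖a.pos t‖)
    (fun t ht => ?_) ht
  have hr := norm_pos ht
  have h2 : ∀ t, ‖a.pos t‖ = √((a.pos t).re ^ 2 + (a.pos t).im ^ 2) := fun t => by
    rw [← Complex.sq_norm_sub_sq_re, add_sub_cancel, Real.sqrt_sq (norm_nonneg _)]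
  have hv : ∀ t, ‖a.vel t‖ ^ 2 = (a.vel t).re ^ 2 + (a.vel t).im ^ 2 := fun t => by
    rw [← Complex.sq_norm_sub_sq_re, add_sub_cancel]
  have hs : HasDerivWithinAt (fun t => ‖a.pos t‖) (((a.pos t).re * (a.vel t).re +
      (a.pos t).im * (a.vel t).im) / ‖a.pos t‖) (Set.Icc a.tA a.tB) t := by
    have h0 : HasDerivWithinAt (fun t => (a.pos t).re ^ 2 + (a.pos t).im ^ 2)
        (2 * ((a.pos t).re * (a.vel t).re + (a.pos t).im * (a.vel t).im))
        (Set.Icc a.tA a.tB) t :=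
      (((hasDeriv_re ht).pow 2).add ((hasDeriv_im ht).pow 2)).congr_deriv (by ring)
    have h1 : (a.pos t).re ^ 2 + (a.pos t).im ^ 2 ≠ 0 := by
      rw [← Complex.sq_norm_sub_sq_re, add_sub_cancel]
      positivity
    have h := h0.sqrt h1
    simp only [← h2] at h
    exact h.congr_deriv (by field_simp)
  have h := (((((hasDeriv_vel_re ht).pow 2).add ((hasDeriv_vel_im ht).pow 2)).div_const 2)).sub
    ((hasDerivWithinAt_const t _ (1:ℝ)).div hs hr.ne')
  simp only [hv]
  refine h.congr_deriv ?_
  field_simp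
  ring

/-- The image of a direct arc lies in an open half-plane bounded by a line through the center. -/
theorem IsDirect.exists_halfPlane (h : a.IsDirect) :
    ∃ α β : ℝ, ∀ t ∈ Set.Icc a.tA a.tB, 0 < α * (a.pos t).re + β * (a.pos t).im := by
  have hc : IsCompact (a.pos '' Set.Icc a.tA a.tB) :=
    isCompact_Icc.image_of_continuousOn fun t ht => (a.hasDeriv_pos t ht).continuousWithinAt
  obtain ⟨f, u, hu, hf⟩ := geometric_hahn_banach_point_closed (convex_convexHull ℝ _)
    hc.convexHull_of_finiteDimensional.isClosed h
  refine ⟨f 1, f Complex.I, fun t ht => ?_⟩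
  have h1 := hf _ (subset_convexHull ℝ _ ⟨t, ht, rfl⟩)
  have h2 : a.pos t = (a.pos t).re • (1 : ℂ) + (a.pos t).im • Complex.I := by
    simp [Complex.re_add_im]
  rw [h2, map_add, map_smul, map_smul, smul_eq_mul, smul_eq_mul] at h1
  rw [map_zero] at hu
  linarith

theorem isDirect_of_halfPlane {f : ℂ →ₗ[ℝ] ℝ} (h : ∀ t ∈ Set.Icc a.tA a.tB, 0 < f (a.pos t)) :
    a.IsDirect := fun h0 => by
  have hsub : convexHull ℝ (a.pos '' Set.Icc a.tA a.tB) ⊆ {z | 0 < f z} :=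
    convexHull_min (by rintro _ ⟨t, ht, rfl⟩; exact h t ht) (convex_halfSpace_gt f.isLinear 0)
  simpa using hsub h0

/-- A direct arc with nonzero angular momentum which joins two points of the upper half-plane that
are symmetric with respect to `Oy` remains in this half-plane, and the angular momentum has the sign
of the abscissa of the initial point. -/
theorem IsDirect.im_pos (h : a.IsDirect) {C : ℝ}
    (hC : ∀ t ∈ Set.Icc a.tA a.tB, a.angularMomentum t = C) (hC0 : C ≠ 0)
    (hre : (a.pos a.tB).re = -(a.pos a.tA).re) (him : (a.pos a.tB).im = (a.pos a.tA).im)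
    (hpos : 0 < (a.pos a.tA).im) :
    0 < C * (a.pos a.tA).re ∧ ∀ t ∈ Set.Icc a.tA a.tB, 0 < (a.pos t).im := by
  obtain ⟨α, β, hf⟩ := h.exists_halfPlane
  have hA := hf _ a.left_mem
  have hB := hf _ a.right_mem
  rw [hre, him] at hB
  -- The sum of `hA` and `hB` is `2 β y_A > 0`.
  have hβ : 0 < β := by nlinarith
  have hn : 0 < α ^ 2 + β ^ 2 := by positivity
  -- Up to the factor `-C`, this is a tangent of the polar angle measured from the axis `(α, β)`.
  -- The factor makes `z` increasing whatever the sign of `C`.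
  set z : ℝ → ℝ := fun t => -C * ((β * (a.pos t).re - α * (a.pos t).im) /
    (α * (a.pos t).re + β * (a.pos t).im)) with hz
  have hd : ∀ t ∈ Set.Icc a.tA a.tB, HasDerivWithinAt z
      ((α ^ 2 + β ^ 2) * C ^ 2 / (α * (a.pos t).re + β * (a.pos t).im) ^ 2)
      (Set.Icc a.tA a.tB) t := fun t ht => by
    have h1 := (((hasDeriv_re ht).const_mul β).sub ((hasDeriv_im ht).const_mul α)).div
      (((hasDeriv_re ht).const_mul α).add ((hasDeriv_im ht).const_mul β)) (hf t ht).ne'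
    refine (h1.const_mul (-C)).congr_deriv ?_
    have := hC t ht
    rw [angularMomentum] at this
    rw [mul_div_assoc', Pi.add_apply, Pi.sub_apply, ← this]
    congr 1
    ring
  have hmono : StrictMonoOn z (Set.Icc a.tA a.tB) :=
    strictMonoOn_of_hasDerivWithinAt_pos (convex_Icc _ _)
      (fun t ht => (hd t ht).continuousWithinAt)
      (fun t ht => (hd t (interior_subset ht)).mono interior_subset) fun t ht => by
        have := hf t (interior_subset ht)
        positivity
  have hAB := hmono a.left_mem a.right_mem a.tA_lt_tB
  constructor
  · simp only [hz, hre, him] at hAB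
    rw [neg_mul, neg_mul, neg_lt_neg_iff, ← mul_div_assoc, ← mul_div_assoc,
      div_lt_div_iff₀ hB hA] at hAB
    have h3 : 0 < (2 * (α ^ 2 + β ^ 2) * (a.pos a.tA).im) * (C * (a.pos a.tA).re) := by nlinarith
    exact (mul_pos_iff_of_pos_left (by positivity)).1 h3
  · intro t ht
    have h1 := hmono.monotoneOn a.left_mem ht ht.1
    have h2 := hmono.monotoneOn ht a.right_mem ht.2
    -- The ratio of `y` to `α x + β y` is an affine function of the monotone quantity `z`. Being
    -- positive at both ends, it is positive in between.
    have hG : ∀ t ∈ Set.Icc a.tA a.tB, (α ^ 2 + β ^ 2) * (a.pos t).im /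
        (α * (a.pos t).re + β * (a.pos t).im) = β - α * ((β * (a.pos t).re - α * (a.pos t).im) /
          (α * (a.pos t).re + β * (a.pos t).im)) := fun t ht => by
      have := (hf t ht).ne'
      field_simp
      ring
    have hGA := hG _ a.left_mem
    have hGB := hG _ a.right_mem
    have hGt := hG t ht
    have hA' : 0 < (α ^ 2 + β ^ 2) * (a.pos a.tA).im /
        (α * (a.pos a.tA).re + β * (a.pos a.tA).im) := div_pos (mul_pos hn hpos) hA
    have hB' : 0 < (α ^ 2 + β ^ 2) * (a.pos a.tB).im /
        (α * (a.pos a.tB).re + β * (a.pos a.tB).im) :=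
      div_pos (mul_pos hn (him ▸ hpos)) (hf _ a.right_mem)
    have key : 0 < (α ^ 2 + β ^ 2) * (a.pos t).im / (α * (a.pos t).re + β * (a.pos t).im) := by
      simp only [hz, neg_mul, neg_le_neg_iff] at h1 h2
      rw [hGA] at hA'
      rw [hGB] at hB'
      rw [hGt]
      rcases hC0.lt_or_gt with hC' | hC'
      · rw [mul_le_mul_left_of_neg hC'] at h1 h2
        rcases le_total 0 α with hα | hα <;> nlinarith
      · rw [mul_le_mul_iff_right₀ hC'] at h1 h2
        rcases le_total 0 α with hα | hα <;> nlinarith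
    rw [div_pos_iff_of_pos_right (hf t ht)] at key
    exact (mul_pos_iff_of_pos_left hn).1 key

end KeplerArc

/-! ### Arcs of conics and their transformation into rectilinear arcs -/

namespace KeplerArc

variable {a : KeplerArc} {t η : ℝ}

theorem sq_norm_pos_eq (a : KeplerArc) (t : ℝ) :
    ‖a.pos t‖ ^ 2 = (a.pos t).re ^ 2 + (a.pos t).im ^ 2 := by
  rw [← Complex.sq_norm_sub_sq_re, add_sub_cancel]

/-- The velocity on a conic of signed eccentricity `η` (the hodograph is a circle). -/
theorem HasSignedEccentricity.vel_eq (h : a.HasSignedEccentricity η)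
    (ht : t ∈ Set.Icc a.tA a.tB) :
    (a.vel t).re = (η * ‖a.pos t‖ - (a.pos t).im) / (a.angularMomentum t * ‖a.pos t‖) ∧
    (a.vel t).im = (a.pos t).re / (a.angularMomentum t * ‖a.pos t‖) := by
  obtain ⟨hC0, hr⟩ := h t ht
  have hrpos := norm_pos ht
  set C := a.angularMomentum t with hC
  have hCt : (a.pos t).re * (a.vel t).im - (a.pos t).im * (a.vel t).re = C := rfl
  have hdiff : (a.pos t).re * (a.vel t).re + (a.pos t).im * (a.vel t).im =
      ‖a.pos t‖ * (η * (a.vel t).im) := by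
    -- Differentiate both sides of `x² + y² = (C² + η y)²`, with `C` constant. Together with the
    -- definition of `C`, the result is a linear system for the velocity.
    have h1 : HasDerivWithinAt (fun t => (a.pos t).re ^ 2 + (a.pos t).im ^ 2) _
        (Set.Icc a.tA a.tB) t := ((hasDeriv_re ht).pow 2).add ((hasDeriv_im ht).pow 2)
    have h2 := (((hasDeriv_im ht).const_mul η).const_add (C ^ 2)).pow 2
    have h3 := h1.congr (f₁ := fun t => (C ^ 2 + η * (a.pos t).im) ^ 2) (fun s hs => ?_) ?_
    · have h4 := (uniqueDiff ht).eq_deriv _ h3 h2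
      have h5 : C ^ 2 + η * (a.pos t).im = ‖a.pos t‖ := by linarith
      rw [h5] at h4
      norm_num at h4
      linarith
    · have h5 := (h s hs).2
      rw [angularMomentum_eq hs, ← angularMomentum_eq ht, ← hC] at h5
      have := a.sq_norm_pos_eq s
      rw [show C ^ 2 + η * (a.pos s).im = ‖a.pos s‖ by linarith]
      exact this
    · have := a.sq_norm_pos_eq t
      rw [show C ^ 2 + η * (a.pos t).im = ‖a.pos t‖ by linarith]
      exact this
  have hsq := a.sq_norm_pos_eq t
  generalize (a.pos t).re = x at *
  generalize (a.pos t).im = y at *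
  generalize (a.vel t).re = p at *
  generalize (a.vel t).im = q at *
  generalize ‖a.pos t‖ = r at *
  clear_value C
  have hq : q * (C * r) = x := by
    apply mul_right_cancel₀ hC0
    have : q * (C * r) * C = q * r * (r - η * y) := by rw [hr]; ring
    rw [this]
    linear_combination y * hdiff + q * hsq + x * hCt
  have hp : p * (C * r) = η * r - y := by
    apply mul_right_cancel₀ (mul_ne_zero hrpos.ne' hC0)
    have : r ^ 2 * (p * C) = C * (x * (r * (η * q)) - y * C) := by
      rw [hsq]; linear_combination C * x * hdiff - C * y * hCt
    linear_combination C * this + C * η * x * hq + y * C * hr - C * η * hsq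
  constructor
  · rw [eq_div_iff (by positivity), hp]
  · rw [eq_div_iff (by positivity), hq]

/-- The energy on a conic of signed eccentricity `η`. -/
theorem HasSignedEccentricity.hasEnergy (h : a.HasSignedEccentricity η) :
    a.HasEnergy ((η ^ 2 - 1) / (2 * (‖a.pos a.tA‖ - η * (a.pos a.tA).im))) := by
  intro t ht
  obtain ⟨hp, hq⟩ := h.vel_eq ht
  obtain ⟨hC0, hr⟩ := h t ht
  have hrA := (h _ a.left_mem).2
  rw [← angularMomentum_eq ht] at hrA
  have hrpos := norm_pos ht
  have hsq := a.sq_norm_pos_eq t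
  have hv : ‖a.vel t‖ ^ 2 = (a.vel t).re ^ 2 + (a.vel t).im ^ 2 := by
    rw [← Complex.sq_norm_sub_sq_re, add_sub_cancel]
  rw [hv, hp, hq, hrA]
  generalize a.angularMomentum t = C at *
  field_simp
  linear_combination (-1 : ℝ) * hsq + 2 * ‖a.pos t‖ * hr

/-- A solution `X` of `X'' = -1 / X ^ 2` with positive values is a rectilinear arc. -/
theorem exists_isDirectRectilinear {X W : ℝ → ℝ} {s₀ s₁ : ℝ} (hs : s₀ < s₁)
    (hX : ∀ s ∈ Set.Icc s₀ s₁, HasDerivWithinAt X (W s) (Set.Icc s₀ s₁) s)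
    (hW : ∀ s ∈ Set.Icc s₀ s₁, HasDerivWithinAt W (-1 / X s ^ 2) (Set.Icc s₀ s₁) s)
    (hpos : ∀ s ∈ Set.Icc s₀ s₁, 0 < X s) :
    ∃ b, IsDirectRectilinear (X s₀) (X s₁) (W s₀) b ∧ b.elapsedTime = s₁ - s₀ := by
  let b : KeplerArc :=
    { tA := s₀
      tB := s₁
      tA_lt_tB := hs
      pos := fun s => (X s : ℂ)
      vel := fun s => (W s : ℂ)
      pos_ne_zero := fun s hs => Complex.ofReal_ne_zero.2 (hpos s hs).ne'
      hasDeriv_pos := fun s hs => (hX s hs).ofReal_comp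
      hasDeriv_vel := fun s hs => by
        refine (hW s hs).ofReal_comp.congr_deriv ?_
        have h := hpos s hs
        rw [Complex.norm_real, Real.norm_of_nonneg h.le, ← Complex.ofReal_neg,
          ← Complex.ofReal_div]
        congr 1
        field_simp }
  refine ⟨b, ⟨⟨rfl, rfl⟩, ?_, ⟨1, one_ne_zero, fun s hs => ⟨X s, (hpos s hs).le, ?_⟩⟩, rfl⟩, rfl⟩
  · exact isDirect_of_halfPlane (f := Complex.reCLM.toLinearMap) fun s hs => hpos s hs
  · exact (mul_one _).symm

/-- A direct symmetric arc `(x, y)` is transformed into a direct rectilinear arc with the same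
elapsed time by `X = r ± x`, where the new time is `t ± C y`. -/
theorem IsDirectSymmetric.exists_isDirectRectilinear {A B : ℂ} (h : IsDirectSymmetric A B η a)
    (hre : B.re = -A.re) (him : B.im = A.im) (hpos : 0 < A.im) :
    ∃ b, IsDirectRectilinear (‖A‖ + |A.re|) (‖A‖ - |A.re|)
      ((η - A.im / (‖A‖ + |A.re|)) / √(‖A‖ - η * A.im)) b ∧ b.elapsedTime = a.elapsedTime := by
  obtain ⟨⟨rfl, rfl⟩, hdir, hecc⟩ := h
  set C := a.angularMomentum a.tA with hCdef
  have hC : ∀ t ∈ Set.Icc a.tA a.tB, a.angularMomentum t = C := fun t ht => angularMomentum_eq ht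
  have hC0 : C ≠ 0 := (hecc _ a.left_mem).1
  obtain ⟨hsign, hy⟩ := hdir.im_pos hC hC0 hre him hpos
  have hr : ∀ t ∈ Set.Icc a.tA a.tB, ‖a.pos t‖ = C ^ 2 + η * (a.pos t).im := fun t ht => by
    rw [← hC t ht, ← (hecc t ht).2]; ring
  obtain ⟨σ, hσ, hσx, hσC⟩ : ∃ σ : ℝ, σ ^ 2 = 1 ∧ σ * (a.pos a.tA).re = |(a.pos a.tA).re| ∧
      σ * C = |C| := by
    rcases mul_pos_iff.1 hsign with ⟨h1, h2⟩ | ⟨h1, h2⟩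
    · exact ⟨1, by norm_num, by rw [abs_of_pos h2, one_mul], by rw [abs_of_pos h1, one_mul]⟩
    · exact ⟨-1, by norm_num, by rw [abs_of_neg h2, neg_one_mul],
        by rw [abs_of_neg h1, neg_one_mul]⟩
  have hσ0 : σ ≠ 0 := fun h => by norm_num [h] at hσ
  have hsqrt : √(‖a.pos a.tA‖ - η * (a.pos a.tA).im) = σ * C := by
    rw [hr _ a.left_mem, add_sub_cancel_right, Real.sqrt_sq_eq_abs, hσC]
  set X : ℝ → ℝ := fun t => ‖a.pos t‖ + σ * (a.pos t).re with hXdef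
  set W : ℝ → ℝ := fun t => σ * (η - (a.pos t).im / X t) / C with hWdef
  -- Since `y > 0`, one has `|x| < r`.
  have hXpos : ∀ t ∈ Set.Icc a.tA a.tB, 0 < X t := fun t ht => by
    have h1 := a.sq_norm_pos_eq t
    have h2 : (σ * (a.pos t).re) ^ 2 < ‖a.pos t‖ ^ 2 := by
      rw [mul_pow, hσ, h1, one_mul]
      have := hy t ht
      nlinarith
    have := (abs_lt.1 (abs_lt_of_sq_lt_sq h2 (norm_nonneg _))).1
    simp only [hXdef]
    linarith
  have hX : ∀ t ∈ Set.Icc a.tA a.tB,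
      HasDerivWithinAt X (W t * (X t / ‖a.pos t‖)) (Set.Icc a.tA a.tB) t := fun t ht => by
    have h1 := (((hasDeriv_im ht).const_mul η).const_add (C ^ 2)).add
      ((hasDeriv_re ht).const_mul σ)
    refine (h1.congr (fun s hs => ?_) ?_).congr_deriv ?_
    · simp only [hXdef, hr s hs, Pi.add_apply]
    · simp only [hXdef, hr t ht, Pi.add_apply]
    · obtain ⟨hp, hq⟩ := hecc.vel_eq ht
      rw [hp, hq, hC t ht, hWdef]
      have h2 := hXpos t ht
      have h3 := norm_pos ht
      field_simp
      simp only [hXdef]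
      linear_combination (-η * (a.pos t).re) * hσ
  have hW : ∀ t ∈ Set.Icc a.tA a.tB,
      HasDerivWithinAt W (-1 / X t ^ 2 * (X t / ‖a.pos t‖)) (Set.Icc a.tA a.tB) t := fun t ht => by
    have h2 := hXpos t ht
    have h3 := norm_pos ht
    have h1 := ((((hasDeriv_im ht).div (hX t ht) h2.ne').const_sub η).const_mul σ).div_const C
    refine h1.congr_deriv ?_
    rw [(hecc.vel_eq ht).2, hC t ht, hWdef]
    have h4 := hr t ht
    have h5 := a.sq_norm_pos_eq t
    field_simp
    have h6 : X t = ‖a.pos t‖ + σ * (a.pos t).re := rfl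
    linear_combination ((a.pos t).im * (η * X t - (a.pos t).im) - (a.pos t).re ^ 2) * hσ -
      X t * h4 + (‖a.pos t‖ - σ * (a.pos t).re) * h6 + h5
  -- The new time: `y' = x / (C r)` gives `1 + σ C y' = X / r`.
  have hτ : ∀ t ∈ Set.Icc a.tA a.tB, HasDerivWithinAt (fun t => t + σ * C * (a.pos t).im)
      (X t / ‖a.pos t‖) (Set.Icc a.tA a.tB) t := fun t ht => by
    refine ((hasDerivWithinAt_id t _).add ((hasDeriv_im ht).const_mul (σ * C))).congr_deriv ?_
    rw [(hecc.vel_eq ht).2, hC t ht]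
    have h3 := norm_pos ht
    field_simp
    rfl
  obtain ⟨hlt, g, hgA, hgB, hg⟩ := exists_inverse_of_hasDerivWithinAt_pos a.tA_lt_tB hτ
    fun t ht => div_pos (hXpos t ht) (norm_pos ht)
  have hmaps := fun s hs => (hg s hs).1
  have hne : ∀ t ∈ Set.Icc a.tA a.tB, X t / ‖a.pos t‖ ≠ 0 := fun t ht =>
    (div_pos (hXpos t ht) (norm_pos ht)).ne'
  obtain ⟨b, hb, hbT⟩ := KeplerArc.exists_isDirectRectilinear (X := X ∘ g) (W := W ∘ g) hlt
    (fun s hs => ((hX _ (hmaps s hs)).comp s (hg s hs).2 hmaps).congr_deriv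
      (mul_inv_cancel_right₀ (hne _ (hmaps s hs)) _))
    (fun s hs => ((hW _ (hmaps s hs)).comp s (hg s hs).2 hmaps).congr_deriv
      (mul_inv_cancel_right₀ (hne _ (hmaps s hs)) _))
    fun s hs => hXpos _ (hmaps s hs)
  have hnorm : ‖a.pos a.tB‖ = ‖a.pos a.tA‖ := by
    rw [hr _ a.left_mem, hr _ a.right_mem, him]
  refine ⟨b, ?_, hbT.trans ?_⟩
  · have e1 : (X ∘ g) (a.tA + σ * C * (a.pos a.tA).im) = ‖a.pos a.tA‖ + |(a.pos a.tA).re| := by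
      simp only [Function.comp_apply, hgA, hXdef, hσx]
    have e2 : (X ∘ g) (a.tB + σ * C * (a.pos a.tB).im) = ‖a.pos a.tA‖ - |(a.pos a.tA).re| := by
      simp only [Function.comp_apply, hgB, hXdef, ← hσx, hnorm, hre]
      ring
    have e3 : (W ∘ g) (a.tA + σ * C * (a.pos a.tA).im) =
        (η - (a.pos a.tA).im / (‖a.pos a.tA‖ + |(a.pos a.tA).re|)) /
          √(‖a.pos a.tA‖ - η * (a.pos a.tA).im) := by
      simp only [Function.comp_apply, hgA, hWdef, hXdef, hσx, hsqrt]
      rw [div_eq_div_iff hC0 (mul_ne_zero hσ0 hC0)]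
      linear_combination ((η - (a.pos a.tA).im / (‖a.pos a.tA‖ + |(a.pos a.tA).re|)) * C) * hσ
    rwa [e1, e2, e3] at hb
  -- The correction `σ C y` takes the same value at both ends and cancels.
  · rw [him, elapsedTime]
    ring

end KeplerArc

/-! ### Uniqueness of rectilinear arcs -/

/-- Uniqueness for the Cauchy problem of `X'' = -1 / X ^ 2` on the half-line of positive abscissas. -/
theorem rectilinear_motion_unique {X V Y W : ℝ → ℝ} {T : ℝ}
    (hX : ∀ t ∈ Set.Icc 0 T, HasDerivWithinAt X (V t) (Set.Icc 0 T) t)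
    (hV : ∀ t ∈ Set.Icc 0 T, HasDerivWithinAt V (-1 / X t ^ 2) (Set.Icc 0 T) t)
    (hY : ∀ t ∈ Set.Icc 0 T, HasDerivWithinAt Y (W t) (Set.Icc 0 T) t)
    (hW : ∀ t ∈ Set.Icc 0 T, HasDerivWithinAt W (-1 / Y t ^ 2) (Set.Icc 0 T) t)
    (hXpos : ∀ t ∈ Set.Icc 0 T, 0 < X t) (hYpos : ∀ t ∈ Set.Icc 0 T, 0 < Y t)
    (h0 : X 0 = Y 0) (h0' : V 0 = W 0) : ∀ t ∈ Set.Icc 0 T, X t = Y t := by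
  have hXc : ContinuousOn X (Set.Icc 0 T) := fun t ht => (hX t ht).continuousWithinAt
  have hYc : ContinuousOn Y (Set.Icc 0 T) := fun t ht => (hY t ht).continuousWithinAt
  -- The difference of the two accelerations is `k (X - Y)`, and `k` is bounded on the compact
  -- interval.
  set k : ℝ → ℝ := fun t => (X t + Y t) / (X t ^ 2 * Y t ^ 2) with hk
  have hkc : ContinuousOn k (Set.Icc 0 T) := (hXc.add hYc).div ((hXc.pow 2).mul (hYc.pow 2))
    fun t ht => by have := hXpos t ht; have := hYpos t ht; positivity
  obtain ⟨K, hK⟩ := (isCompact_Icc.image_of_continuousOn hkc).bddAbove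
  have hkK : ∀ t ∈ Set.Icc 0 T, k t ≤ K := fun t ht => hK ⟨t, ht, rfl⟩
  -- Grönwall's argument: the exponential weight makes `E` nonincreasing, while `E 0 = 0` and `E ≥
  -- 0`.
  set E : ℝ → ℝ := fun t => ((X t - Y t) ^ 2 + (V t - W t) ^ 2) * Real.exp (-(1 + K) * t) with hE
  have hd : ∀ t ∈ Set.Icc 0 T, HasDerivWithinAt E
      ((2 * (X t - Y t) * (V t - W t) * (1 + k t) -
        (1 + K) * ((X t - Y t) ^ 2 + (V t - W t) ^ 2)) * Real.exp (-(1 + K) * t))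
      (Set.Icc 0 T) t := fun t ht => by
    have h1 := ((((hX t ht).sub (hY t ht)).pow 2).add (((hV t ht).sub (hW t ht)).pow 2)).mul
      (((hasDerivWithinAt_id t (Set.Icc 0 T)).const_mul (-(1 + K))).exp)
    refine h1.congr_deriv ?_
    have := hXpos t ht
    have := hYpos t ht
    simp only [hk, Pi.add_apply, Pi.pow_apply, Pi.sub_apply, id]
    field_simp
    ring
  have hanti : AntitoneOn E (Set.Icc 0 T) := by
    refine antitoneOn_of_hasDerivWithinAt_nonpos (convex_Icc _ _)
      (fun t ht => (hd t ht).continuousWithinAt)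
      (fun t ht => (hd t (interior_subset ht)).mono interior_subset) fun t ht => ?_
    have ht := interior_subset ht
    have h1 := hkK t ht
    have h2 : 0 < k t := by
      have := hXpos t ht
      have := hYpos t ht
      positivity
    refine mul_nonpos_of_nonpos_of_nonneg ?_ (Real.exp_pos _).le
    have h3 : 2 * (X t - Y t) * (V t - W t) ≤ (X t - Y t) ^ 2 + (V t - W t) ^ 2 :=
      two_mul_le_add_sq _ _
    have h4 := mul_le_mul_of_nonneg_right h3 (by positivity : 0 ≤ 1 + k t)
    have h5 : 0 ≤ (X t - Y t) ^ 2 + (V t - W t) ^ 2 := by positivity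
    nlinarith
  intro t ht
  have h1 := hanti ⟨le_rfl, ht.1.trans ht.2⟩ ht ht.1
  have h2 : E 0 = 0 := by simp [hE, h0, h0']
  rw [h2] at h1
  have h3 : (X t - Y t) ^ 2 + (V t - W t) ^ 2 ≤ 0 :=
    nonpos_of_mul_nonpos_left h1 (Real.exp_pos _)
  have h4 : (X t - Y t) ^ 2 = 0 := by nlinarith [sq_nonneg (X t - Y t), sq_nonneg (V t - W t)]
  exact sub_eq_zero.1 (pow_eq_zero_iff two_ne_zero |>.1 h4)

namespace KeplerArc

variable {a b : KeplerArc} {t : ℝ} {xA xB v : ℝ}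

/-- The initial point identifies the ray as the positive half-axis, and the arc cannot leave it
because it avoids `O`. -/
theorem IsDirectRectilinear.re_pos_and_im_eq_zero (h : IsDirectRectilinear xA xB v a)
    (hxA : 0 < xA) (ht : t ∈ Set.Icc a.tA a.tB) : 0 < (a.pos t).re ∧ (a.pos t).im = 0 := by
  obtain ⟨⟨hA, -⟩, -, ⟨u, hu, hray⟩, -⟩ := h
  obtain ⟨s₀, hs₀, h0⟩ := hray _ a.left_mem
  obtain ⟨s, hs, h1⟩ := hray _ ht
  rw [hA] at h0
  have hre := congrArg Complex.re h0
  have him := congrArg Complex.im h0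
  simp only [Complex.ofReal_re, Complex.ofReal_im, Complex.re_ofReal_mul,
    Complex.im_ofReal_mul] at hre him
  have hs₀' : 0 < s₀ := hs₀.lt_of_ne (by rintro rfl; linarith)
  have hure : 0 < u.re := (mul_pos_iff_of_pos_left hs₀').1 (hre ▸ hxA)
  have huim : u.im = 0 := (mul_eq_zero.1 him.symm).resolve_left hs₀'.ne'
  have hs' : 0 < s := hs.lt_of_ne (by
    rintro rfl
    exact a.pos_ne_zero t ht (by rw [h1, Complex.ofReal_zero, zero_mul]))
  rw [h1, Complex.re_ofReal_mul, Complex.im_ofReal_mul, huim, mul_zero]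
  exact ⟨mul_pos hs' hure, rfl⟩

theorem IsDirectRectilinear.hasDeriv_vel_re (h : IsDirectRectilinear xA xB v a)
    (hxA : 0 < xA) (ht : t ∈ Set.Icc a.tA a.tB) :
    HasDerivWithinAt (fun t => (a.vel t).re) (-1 / (a.pos t).re ^ 2) (Set.Icc a.tA a.tB) t := by
  obtain ⟨h1, h2⟩ := h.re_pos_and_im_eq_zero hxA ht
  have h3 : ‖a.pos t‖ = (a.pos t).re := by
    rw [← abs_of_pos h1, Complex.abs_re_eq_norm.2 h2]
  refine (KeplerArc.hasDeriv_vel_re ht).congr_deriv ?_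
  rw [h3]
  field_simp

/-- The energy of a rectilinear arc. -/
theorem IsDirectRectilinear.hasEnergy (h : IsDirectRectilinear xA xB v a) (hxA : 0 < xA) :
    a.HasEnergy (v ^ 2 / 2 - 1 / xA) := by
  have := a.hasEnergy
  rwa [h.1.1, h.2.2.2, Complex.norm_real, Complex.norm_real, Real.norm_of_nonneg hxA.le,
    Real.norm_eq_abs, sq_abs] at this

/-- By uniqueness the longer arc would already be at `xB` when the shorter one stops, and again at
its own end. The mean value theorem gives a negative velocity on the way from `xA` to `xB` and a
later zero velocity, which is impossible since the velocity is nonincreasing. -/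
theorem IsDirectRectilinear.elapsedTime_not_lt (ha : IsDirectRectilinear xA xB v a)
    (hb : IsDirectRectilinear xA xB v b) (hxB : 0 < xB) (hxBA : xB < xA) :
    ¬ a.elapsedTime < b.elapsedTime := by
  intro hlt
  have hxA := hxB.trans hxBA
  set T := a.elapsedTime with hT
  have hT0 : 0 < T := sub_pos.2 a.tA_lt_tB
  have shift : ∀ (c : KeplerArc) {f f' : ℝ → ℝ}, T ≤ c.elapsedTime →
      (∀ t ∈ Set.Icc c.tA c.tB, HasDerivWithinAt f (f' t) (Set.Icc c.tA c.tB) t) →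
      ∀ t ∈ Set.Icc 0 T, HasDerivWithinAt (fun t => f (t + c.tA)) (f' (t + c.tA))
        (Set.Icc 0 T) t := fun c f f' hc hf t ht => by
    have hmaps : Set.MapsTo (fun t => t + c.tA) (Set.Icc 0 T) (Set.Icc c.tA c.tB) :=
      fun s hs => ⟨by linarith [hs.1], by rw [elapsedTime] at hc; linarith [hs.2]⟩
    exact ((hf _ (hmaps ht)).comp t ((hasDerivWithinAt_id t _).add_const c.tA) hmaps).congr_deriv
      (mul_one _)
  have mem : ∀ (c : KeplerArc), T ≤ c.elapsedTime → ∀ t ∈ Set.Icc 0 T,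
      t + c.tA ∈ Set.Icc c.tA c.tB :=
    fun c hc s hs => ⟨by linarith [hs.1], by rw [elapsedTime] at hc; linarith [hs.2]⟩
  have huniq := rectilinear_motion_unique
    (shift a le_rfl fun t ht => hasDeriv_re ht)
    (shift a le_rfl fun t ht => ha.hasDeriv_vel_re hxA ht)
    (shift b hlt.le fun t ht => hasDeriv_re ht)
    (shift b hlt.le fun t ht => hb.hasDeriv_vel_re hxA ht)
    (fun t ht => (ha.re_pos_and_im_eq_zero hxA (mem a le_rfl t ht)).1)
    (fun t ht => (hb.re_pos_and_im_eq_zero hxA (mem b hlt.le t ht)).1)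
    (by simp only [zero_add, ha.1.1, hb.1.1]) (by simp only [zero_add, ha.2.2.2, hb.2.2.2])
    T ⟨hT0.le, le_rfl⟩
  have hTa : T + a.tA = a.tB := by rw [hT, elapsedTime]; ring
  simp only [hTa, ha.1.2, Complex.ofReal_re] at huniq
  set m := T + b.tA with hm
  have hm1 : b.tA < m := by linarith
  have hm2 : m < b.tB := by
    have : b.elapsedTime = b.tB - b.tA := rfl
    linarith
  have hcont : ContinuousOn (fun t => (b.pos t).re) (Set.Icc b.tA b.tB) :=
    fun t ht => (hasDeriv_re ht).continuousWithinAt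
  have hderiv : ∀ t ∈ Set.Ioo b.tA b.tB, HasDerivAt (fun t => (b.pos t).re) (b.vel t).re t :=
    fun t ht => (hasDeriv_re ⟨ht.1.le, ht.2.le⟩).hasDerivAt (Icc_mem_nhds ht.1 ht.2)
  obtain ⟨c, hc, hc'⟩ := exists_hasDerivAt_eq_slope (fun t => (b.pos t).re) (fun t => (b.vel t).re)
    hm1 (hcont.mono (Set.Icc_subset_Icc_right hm2.le)) fun t ht => hderiv t ⟨ht.1, ht.2.trans hm2⟩
  obtain ⟨d, hd, hd'⟩ := exists_hasDerivAt_eq_slope (fun t => (b.pos t).re) (fun t => (b.vel t).re)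
    hm2 (hcont.mono (Set.Icc_subset_Icc_left hm1.le)) fun t ht => hderiv t ⟨hm1.trans ht.1, ht.2⟩
  simp only [hb.1.1, hb.1.2, ← huniq, Complex.ofReal_re, sub_self, zero_div] at hc' hd'
  have hneg : (b.vel c).re < 0 := by
    rw [hc']
    exact div_neg_of_neg_of_pos (by linarith) (by linarith)
  have hanti : AntitoneOn (fun t => (b.vel t).re) (Set.Icc b.tA b.tB) :=
    antitoneOn_of_hasDerivWithinAt_nonpos (convex_Icc _ _)
      (fun t ht => (hb.hasDeriv_vel_re hxA ht).continuousWithinAt)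
      (fun t ht => (hb.hasDeriv_vel_re hxA (interior_subset ht)).mono interior_subset)
      fun t ht => div_nonpos_of_nonpos_of_nonneg (by norm_num) (sq_nonneg _)
  have := hanti ⟨hc.1.le, (hc.2.trans hm2).le⟩ ⟨(hm1.trans hd.1).le, hd.2.le⟩ (hc.2.trans hd.1).le
  simp only at this
  linarith

/-- The elapsed time of a direct rectilinear arc depends only on the end points and the initial
velocity. -/
theorem IsDirectRectilinear.elapsedTime_eq (ha : IsDirectRectilinear xA xB v a)
    (hb : IsDirectRectilinear xA xB v b) (hxB : 0 < xB) (hxBA : xB < xA) :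
    a.elapsedTime = b.elapsedTime :=
  le_antisymm (not_lt.1 (hb.elapsedTime_not_lt ha hxB hxBA))
    (not_lt.1 (ha.elapsedTime_not_lt hb hxB hxBA))

end KeplerArc

/-! ### Construction of the direct symmetric arc -/

namespace KeplerArc

theorem im_lt_norm {A : ℂ} (hA : A.re ≠ 0) : A.im < ‖A‖ :=
  (le_abs_self _).trans_lt ((Complex.abs_im_lt_norm).2 hA)

theorem norm_sub_mul_im_pos {A : ℂ} {η : ℝ} (hA : A.re ≠ 0) (hpos : 0 < A.im) (hη : η < 1) :
    0 < ‖A‖ - η * A.im := by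
  have := im_lt_norm hA
  nlinarith

/-- Existence of the direct symmetric arc. The conic is parametrized by the slope `u = ∓ x / y`. -/
theorem exists_isDirectSymmetric {A B : ℂ} {η : ℝ} (hre0 : A.re ≠ 0) (hre : B.re = -A.re)
    (him : B.im = A.im) (hpos : 0 < A.im) (hη : η < 1) :
    ∃ a, IsDirectSymmetric A B η a := by
  obtain ⟨σ, hσ, hσx⟩ : ∃ σ : ℝ, σ ^ 2 = 1 ∧ σ * |A.re| = A.re := by
    rcases hre0.lt_or_gt with h | h
    · exact ⟨-1, by norm_num, by rw [abs_of_neg h]; ring⟩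
    · exact ⟨1, by norm_num, by rw [abs_of_pos h, one_mul]⟩
  have hσ0 : σ ≠ 0 := fun h => by norm_num [h] at hσ
  have hD := norm_sub_mul_im_pos hre0 hpos hη
  set c := √(‖A‖ - η * A.im) with hc
  have hc0 : 0 < c := Real.sqrt_pos.2 hD
  have hc2 : c ^ 2 = ‖A‖ - η * A.im := Real.sq_sqrt hD.le
  -- The parameter is `u = -σ x / y`; it equals `-k` at `A` and `k` at `B`.
  set k := |A.re| / A.im with hk
  have hk0 : 0 < k := div_pos (abs_pos.2 hre0) hpos
  -- This is `r / y`, so the conic `r - η y = c²` reads `y (ρ - η) = c²`. Its denominator never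
  -- vanishes because `ρ ≥ 1 > η`.
  set ρ : ℝ → ℝ := fun u => √(1 + u ^ 2) with hρ
  have hρ2 : ∀ u, ρ u ^ 2 = 1 + u ^ 2 := fun u => Real.sq_sqrt (by positivity)
  have hρ0 : ∀ u, 0 < ρ u := fun u => Real.sqrt_pos.2 (by positivity)
  have hρη : ∀ u, 0 < ρ u - η := fun u => by
    have : 1 ≤ ρ u := Real.one_le_sqrt.2 (by nlinarith)
    linarith
  have hρd : ∀ u, HasDerivAt ρ (u / ρ u) u := fun u => by
    have h := (((hasDerivAt_id u).pow 2).const_add 1).sqrt (by simp; positivity)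
    refine h.congr_deriv ?_
    have := hρ0 u
    simp only [id, hρ, Pi.pow_apply] at this ⊢
    field_simp
    norm_num
  set Y : ℝ → ℝ := fun u => c ^ 2 / (ρ u - η) with hY
  have hY0 : ∀ u, 0 < Y u := fun u => div_pos (pow_pos hc0 2) (hρη u)
  have hYρ : ∀ u, Y u * (ρ u - η) = c ^ 2 := fun u => div_mul_cancel₀ _ (hρη u).ne'
  have hYd : ∀ u, HasDerivAt Y (-(Y u ^ 2 * u / (c ^ 2 * ρ u))) u := fun u => by
    refine ((hasDerivAt_const u (c ^ 2)).div ((hρd u).sub_const η) (hρη u).ne').congr_deriv ?_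
    have := hρ0 u
    have := hρη u
    simp only [hY]
    field_simp
    ring
  have hYc : Continuous Y := continuous_iff_continuousAt.2 fun u => (hYd u).continuousAt
  set x : ℝ → ℝ := fun u => -σ * u * Y u with hx
  -- The velocity components `p`, `q` are those of `HasSignedEccentricity.vel_eq` with `C = σ c`.
  set p : ℝ → ℝ := fun u => σ * (η - (ρ u)⁻¹) / c with hp
  set q : ℝ → ℝ := fun u => -(u / ρ u) / c with hq
  have hxd : ∀ u, HasDerivAt x (p u * (Y u ^ 2 / c)) u := fun u => by
    refine (((hasDerivAt_id u).const_mul (-σ)).mul (hYd u)).congr_deriv ?_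
    have h1 := hρ0 u
    have h2 := hY0 u
    simp only [hp, id]
    field_simp
    linear_combination ρ u * hYρ u - Y u * hρ2 u
  have hyd : ∀ u, HasDerivAt Y (q u * (Y u ^ 2 / c)) u := fun u => by
    refine (hYd u).congr_deriv ?_
    have h1 := hρ0 u
    simp only [hq]
    field_simp
  have hpd : ∀ u, HasDerivAt p (-x u / (Y u * ρ u) ^ 3 * (Y u ^ 2 / c)) u := fun u => by
    refine (((((hρd u).inv (hρ0 u).ne').const_sub η).const_mul σ).div_const c).congr_deriv ?_
    have h1 := hρ0 u
    have h2 := hY0 u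
    simp only [hx]
    field_simp
  have hqd : ∀ u, HasDerivAt q (-Y u / (Y u * ρ u) ^ 3 * (Y u ^ 2 / c)) u := fun u => by
    refine ((((hasDerivAt_id u).div (hρd u) (hρ0 u).ne').neg).div_const c).congr_deriv ?_
    have h1 := hρ0 u
    have h2 := hY0 u
    simp only [id]
    field_simp
    linear_combination (-1 : ℝ) * hρ2 u
  -- Time as a function of `u`: the angular momentum is `σ y² du/dt = σ c`, hence `dt/du = y² / c`.
  -- Inverting this function yields the motion.
  have hTd : ∀ u, HasDerivAt (fun u => ∫ s in (0 : ℝ)..u, Y s ^ 2 / c) (Y u ^ 2 / c) u :=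
    fun u => intervalIntegral.integral_hasDerivAt_right
      (((hYc.pow 2).div_const c).intervalIntegrable 0 u)
      ((hYc.pow 2).div_const c).stronglyMeasurable.stronglyMeasurableAtFilter
      ((hYc.pow 2).div_const c).continuousAt
  have hTd0 : ∀ u, 0 < Y u ^ 2 / c := fun u => div_pos (pow_pos (hY0 u) 2) hc0
  obtain ⟨hlt, g, hgA, hgB, hg⟩ := exists_inverse_of_hasDerivWithinAt_pos
    (neg_lt_self hk0) (fun u _ => (hTd u).hasDerivWithinAt) fun u _ => hTd0 u
  set T : ℝ → ℝ := fun u => ∫ s in (0 : ℝ)..u, Y s ^ 2 / c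
  have hcomp : ∀ {f f' : ℝ → ℝ}, (∀ u, HasDerivAt f (f' u * (Y u ^ 2 / c)) u) →
      ∀ s ∈ Set.Icc (T (-k)) (T k),
        HasDerivWithinAt (fun s => f (g s)) (f' (g s)) (Set.Icc (T (-k)) (T k)) s :=
    fun {f f'} hf s hs => ((hf _).comp_hasDerivWithinAt s (hg s hs).2).congr_deriv
      (mul_inv_cancel_right₀ (hTd0 _).ne' _)
  have hcplx : ∀ {f₁ f₁' f₂ f₂' : ℝ → ℝ}, (∀ u, HasDerivAt f₁ (f₁' u * (Y u ^ 2 / c)) u) →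
      (∀ u, HasDerivAt f₂ (f₂' u * (Y u ^ 2 / c)) u) → ∀ s ∈ Set.Icc (T (-k)) (T k),
        HasDerivWithinAt (fun s => (⟨f₁ (g s), f₂ (g s)⟩ : ℂ)) ⟨f₁' (g s), f₂' (g s)⟩
          (Set.Icc (T (-k)) (T k)) s := fun {f₁ f₁' f₂ f₂'} h₁ h₂ s hs => by
    simp only [Complex.mk_eq_add_mul_I]
    exact (hcomp h₁ s hs).ofReal_comp.add ((hcomp h₂ s hs).ofReal_comp.mul_const Complex.I)
  have hnorm : ∀ u, ‖(⟨x u, Y u⟩ : ℂ)‖ = Y u * ρ u := fun u => by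
    have h : ‖(⟨x u, Y u⟩ : ℂ)‖ ^ 2 = (Y u * ρ u) ^ 2 := by
      rw [Complex.sq_norm, Complex.normSq_mk, mul_pow, hρ2]
      simp only [hx]
      linear_combination (u * Y u) ^ 2 * hσ
    exact (pow_left_inj₀ (norm_nonneg _) (mul_pos (hY0 u) (hρ0 u)).le two_ne_zero).1 h
  let a : KeplerArc :=
    { tA := T (-k)
      tB := T k
      tA_lt_tB := hlt
      pos := fun s => ⟨x (g s), Y (g s)⟩
      vel := fun s => ⟨p (g s), q (g s)⟩
      pos_ne_zero := fun s _ h => (hY0 (g s)).ne' (congrArg Complex.im h)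
      hasDeriv_pos := hcplx hxd hyd
      hasDeriv_vel := fun s hs => by
        refine (hcplx hpd hqd s hs).congr_deriv ?_
        rw [hnorm]
        apply Complex.ext
        · rw [Complex.div_ofReal_re, Complex.neg_re]
        · rw [Complex.div_ofReal_im, Complex.neg_im] }
  have hρk : ρ k * A.im = ‖A‖ := by
    have h : (ρ k * A.im) ^ 2 = ‖A‖ ^ 2 := by
      rw [mul_pow, hρ2, hk, Complex.sq_norm, Complex.normSq_apply, div_pow, sq_abs]
      field_simp
      ring
    exact (pow_left_inj₀ (mul_pos (hρ0 k) hpos).le (norm_nonneg _) two_ne_zero).1 h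
  have hYk : Y k = A.im := by
    simp only [hY]
    rw [div_eq_iff (hρη k).ne', hc2, ← hρk]
    ring
  have hYk' : Y (-k) = A.im := by
    rw [← hYk]
    simp only [hY, hρ, neg_sq]
  have hkA : σ * k * A.im = A.re := by
    rw [mul_assoc, hk, div_mul_cancel₀ _ hpos.ne', hσx]
  have hmom : ∀ s, a.angularMomentum s = σ * c := fun s => by
    change x (g s) * q (g s) - Y (g s) * p (g s) = σ * c
    have h1 := hρ0 (g s)
    simp only [hx, hp, hq]
    field_simp
    linear_combination (-Y (g s)) * hρ2 (g s) + ρ (g s) * hYρ (g s)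
  refine ⟨a, ⟨?_, ?_⟩, ?_, fun s hs => ⟨?_, ?_⟩⟩
  · change (⟨x (g (T (-k))), Y (g (T (-k)))⟩ : ℂ) = A
    rw [hgA]
    apply Complex.ext
    · change -σ * -k * Y (-k) = A.re
      rw [hYk', ← hkA]
      ring
    · exact hYk'
  · change (⟨x (g (T k)), Y (g (T k))⟩ : ℂ) = B
    rw [hgB]
    apply Complex.ext
    · change -σ * k * Y k = B.re
      rw [hYk, hre, ← hkA]
      ring
    · rw [him]
      exact hYk
  · exact isDirect_of_halfPlane (f := Complex.imCLM.toLinearMap) fun s _ => hY0 (g s)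
  · rw [hmom]
    exact mul_ne_zero hσ0 hc0.ne'
  · rw [hmom, mul_pow, hσ, one_mul, ← hYρ (g s)]
    change ‖(⟨x (g s), Y (g s)⟩ : ℂ)‖ - η * Y (g s) = _
    rw [hnorm]
    ring

end KeplerArc

/-! ### The function `v_A` -/

section ChangeOfVariable

variable {xA xB η : ℝ}

/-- For `η ≤ 1` this follows from the strict arithmetic-geometric inequality `(√xA - √xB)² > 0`. -/
theorem changeOfVariable_radicand_pos (hxB : 0 < xB) (hxBA : xB < xA) (hη : η ≤ 1) :
    0 < (xA + xB) / 2 - η * √(xA * xB) := by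
  have hxA := hxB.trans hxBA
  rw [Real.sqrt_mul hxA.le]
  have h1 := Real.sq_sqrt hxA.le
  have h2 := Real.sq_sqrt hxB.le
  have h3 := Real.sqrt_pos.2 hxB
  have h4 := Real.sqrt_lt_sqrt hxB.le hxBA
  have h5 : η * (√xA * √xB) ≤ √xA * √xB :=
    mul_le_of_le_one_left (mul_pos (h3.trans h4) h3).le hη
  nlinarith [mul_pos (sub_pos.2 h4) (sub_pos.2 h4)]

theorem sqrt_div_eq_sqrt_mul_div (hxA : 0 < xA) : √(xB / xA) = √(xA * xB) / xA := by
  rw [Real.sqrt_div' _ hxA.le, Real.sqrt_mul hxA.le]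
  have h1 := Real.sq_sqrt hxA.le
  have h2 := Real.sqrt_pos.2 hxA
  rw [div_eq_div_iff h2.ne' hxA.ne']
  linear_combination (-√xB) * h1

/-- The sign of the derivative is that of `xA - η √(xA xB)`, which is positive as `√(xA xB) < xA`.
The endpoint `η = 1` is included so that monotonicity and the intermediate value theorem reach the
value `v_E`. -/
theorem exists_hasDerivAt_changeOfVariable (hxB : 0 < xB) (hxBA : xB < xA) (hη : η ≤ 1) :
    ∃ d, 0 < d ∧ HasDerivAt (changeOfVariable xA xB) d η := by
  have hxA := hxB.trans hxBA
  have hD := changeOfVariable_radicand_pos hxB hxBA hη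
  have hs := Real.sqrt_pos.2 hD
  have h1 : HasDerivAt (fun η => (xA + xB) / 2 - η * √(xA * xB)) (-√(xA * xB)) η := by
    simpa using ((hasDerivAt_id η).mul_const √(xA * xB)).const_sub ((xA + xB) / 2)
  refine ⟨_, ?_, ((hasDerivAt_id η).sub_const √(xB / xA)).div (h1.sqrt hD.ne') hs.ne'⟩
  have h2 := Real.sq_sqrt hD.le
  have h3 : √(xA * xB) ^ 2 = xA * xB := Real.sq_sqrt (mul_pos hxA hxB).le
  have h4 : 0 < √(xA * xB) := Real.sqrt_pos.2 (mul_pos hxA hxB)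
  have h5 : √(xA * xB) < xA := by
    rw [Real.sqrt_lt' hxA]
    nlinarith
  rw [sqrt_div_eq_sqrt_mul_div hxA]
  refine div_pos ?_ (pow_pos hs 2)
  have h6 : 1 * √((xA + xB) / 2 - η * √(xA * xB)) - (id η - √(xA * xB) / xA) *
      (-√(xA * xB) / (2 * √((xA + xB) / 2 - η * √(xA * xB)))) =
      (xA - η * √(xA * xB)) / (2 * √((xA + xB) / 2 - η * √(xA * xB))) := by
    simp only [id]
    generalize √((xA + xB) / 2 - η * √(xA * xB)) = S at *
    field_simp
    linear_combination 2 * xA * h2 - h3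
  rw [h6]
  refine div_pos ?_ (by positivity)
  nlinarith

theorem changeOfVariable_one (hxB : 0 < xB) (hxBA : xB < xA) :
    changeOfVariable xA xB 1 = √(2 / xA) := by
  have hxA := hxB.trans hxBA
  have hD := changeOfVariable_radicand_pos hxB hxBA le_rfl
  have h1 := Real.sq_sqrt hxA.le
  have h2 := Real.sq_sqrt hxB.le
  have h3 := Real.sqrt_pos.2 hxB
  have h4 := Real.sqrt_lt_sqrt hxB.le hxBA
  have h5 := h3.trans h4
  rw [changeOfVariable, div_eq_iff (Real.sqrt_pos.2 hD).ne', ← Real.sqrt_mul (by positivity)]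
  symm
  rw [Real.sqrt_eq_iff_mul_self_eq (by positivity), Real.sqrt_div' _ hxA.le, Real.sqrt_mul hxA.le]
  · have h6 : (1 - √xB / √xA) * (1 - √xB / √xA) = (√xA - √xB) ^ 2 / √xA ^ 2 := by
      field_simp
    rw [h6, h1]
    field_simp
    linear_combination (-1 : ℝ) * h1 - h2
  · rw [sub_nonneg]
    exact Real.sqrt_le_one.2 ((div_le_one hxA).2 hxBA.le)

theorem strictMonoOn_changeOfVariable (hxB : 0 < xB) (hxBA : xB < xA) :
    StrictMonoOn (changeOfVariable xA xB) (Set.Iic 1) := by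
  refine strictMonoOn_of_deriv_pos (convex_Iic 1) (fun η hη => ?_) fun η hη => ?_
  · obtain ⟨d, -, hd⟩ := exists_hasDerivAt_changeOfVariable hxB hxBA hη
    exact hd.continuousAt.continuousWithinAt
  · obtain ⟨d, hd0, hd⟩ := exists_hasDerivAt_changeOfVariable hxB hxBA
      (Set.mem_Iic.1 (interior_subset hη))
    rwa [hd.deriv]

theorem exists_changeOfVariable_le (hxB : 0 < xB) (hxBA : xB < xA) (v : ℝ) :
    ∃ η ≤ 1, changeOfVariable xA xB η ≤ v := by
  have hxA := hxB.trans hxBA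
  set M := (xA + xB) / 2 + √(xA * xB) with hM
  have hM0 : 0 < M := by positivity
  -- At `η = -L` the radicand is at most `L M`, and `v² L M ≤ L²` by this choice. Hence `v` times
  -- the denominator is at least `-L`, which bounds the numerator from above.
  set L := 1 + v ^ 2 * M with hL
  have hL1 : 1 ≤ L := le_add_of_nonneg_right (by positivity)
  have hη : -L ≤ 1 := by linarith
  have hD := changeOfVariable_radicand_pos hxB hxBA hη
  refine ⟨-L, hη, ?_⟩
  rw [changeOfVariable, div_le_iff₀ (Real.sqrt_pos.2 hD)]
  have h1 : (xA + xB) / 2 - -L * √(xA * xB) ≤ L * M := by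
    rw [hM]
    nlinarith
  have h2 : |v * √((xA + xB) / 2 - -L * √(xA * xB))| ≤ L := by
    refine abs_le_of_sq_le_sq ?_ (by linarith)
    rw [mul_pow, Real.sq_sqrt hD.le]
    have h3 := mul_le_mul_of_nonneg_left h1 (sq_nonneg v)
    nlinarith
  have h3 := (abs_le.1 h2).1
  have h4 := Real.sqrt_nonneg (xB / xA)
  linarith

theorem bijOn_changeOfVariable (hxB : 0 < xB) (hxBA : xB < xA) :
    Set.BijOn (changeOfVariable xA xB) (Set.Iio 1) (Set.Iio √(2 / xA)) := by
  have hmono := strictMonoOn_changeOfVariable hxB hxBA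
  have h1 := changeOfVariable_one hxB hxBA
  refine ⟨fun η hη => ?_, hmono.injOn.mono Set.Iio_subset_Iic_self, fun v hv => ?_⟩
  · rw [← h1]
    exact hmono (Set.mem_Iic.2 (le_of_lt hη)) Set.self_mem_Iic hη
  · obtain ⟨η₀, hη₀, hle⟩ := exists_changeOfVariable_le hxB hxBA v
    have hcont : ContinuousOn (changeOfVariable xA xB) (Set.Icc η₀ 1) := fun η hη => by
      obtain ⟨d, -, hd⟩ := exists_hasDerivAt_changeOfVariable hxB hxBA hη.2
      exact hd.continuousAt.continuousWithinAt
    obtain ⟨η, hη, rfl⟩ := intermediate_value_Icc hη₀ hcont ⟨hle, h1 ▸ le_of_lt hv⟩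
    refine ⟨η, hη.2.lt_of_ne ?_, rfl⟩
    rintro rfl
    rw [h1] at hv
    exact lt_irrefl _ (Set.mem_Iio.1 hv)

theorem contDiffOn_changeOfVariable (hxB : 0 < xB) (hxBA : xB < xA) :
    ContDiffOn ℝ ∞ (changeOfVariable xA xB) (Set.Iio 1) := by
  intro η hη
  have hD := changeOfVariable_radicand_pos hxB hxBA (le_of_lt hη)
  have h : ContDiffAt ℝ ∞ (fun η => (xA + xB) / 2 - η * √(xA * xB)) η := by fun_prop
  exact ((contDiffAt_id.sub contDiffAt_const).div (h.sqrt hD.ne')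
    (Real.sqrt_pos.2 hD).ne').contDiffWithinAt

end ChangeOfVariable

/-! ### Proof of the theorem -/

theorem mainTheorem9 (A B : ℂ) (xA xB : ℝ)
    (hAB : A ≠ B) (hre : B.re = -A.re) (him : B.im = A.im) (hpos : 0 < A.im)
    (hxB : 0 < xB) (hxBA : xB < xA)
    (hchord : ‖A - B‖ = ‖(xA : ℂ) - (xB : ℂ)‖)
    (hsum : ‖A‖ + ‖B‖ = ‖(xA : ℂ)‖ + ‖(xB : ℂ)‖) :
    Set.BijOn (changeOfVariable xA xB) (Set.Iio 1) (Set.Iio √(2 / xA)) ∧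
    ContDiffOn ℝ ∞ (changeOfVariable xA xB) (Set.Iio 1) ∧
    (∀ η < 1, 0 < deriv (changeOfVariable xA xB) η) ∧
    ∃ TS HS TR HR : ℝ → ℝ,
      (∀ η < 1, AreTimeAndEnergy (KeplerArc.IsDirectSymmetric A B η) (TS η) (HS η)) ∧
      (∀ v < √(2 / xA), AreTimeAndEnergy (KeplerArc.IsDirectRectilinear xA xB v) (TR v) (HR v)) ∧
      (∀ η < 1, HS η = (η ^ 2 - 1) / (2 * (‖A‖ - η * A.im))) ∧
      (∀ v < √(2 / xA), HR v = v ^ 2 / 2 - 1 / xA) ∧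
      ∀ η < 1, TS η = TR (changeOfVariable xA xB η) ∧
        HS η = HR (changeOfVariable xA xB η) := by
  have hxA := hxB.trans hxBA
  have hre0 : A.re ≠ 0 := fun h => hAB (Complex.ext (by rw [hre, h, neg_zero]) him.symm)
  have hB : ‖B‖ = ‖A‖ := by
    rw [Complex.norm_def, Complex.norm_def, Complex.normSq_apply, Complex.normSq_apply, hre, him,
      neg_mul_neg]
  have hA2 : ‖A‖ = (xA + xB) / 2 := by
    rw [hB, Complex.norm_real, Complex.norm_real, Real.norm_of_nonneg hxA.le,
      Real.norm_of_nonneg hxB.le] at hsum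
    linarith
  have hre2 : |A.re| = (xA - xB) / 2 := by
    have h1 : A - B = ((2 * A.re : ℝ) : ℂ) :=
      Complex.ext (by simp [hre]; ring) (by simp [him])
    rw [h1, ← Complex.ofReal_sub, Complex.norm_real, Complex.norm_real, Real.norm_eq_abs,
      Real.norm_of_nonneg (sub_pos.2 hxBA).le, abs_mul, abs_two] at hchord
    linarith
  have him2 : A.im = √(xA * xB) := by
    symm
    rw [Real.sqrt_eq_iff_mul_self_eq (by positivity) hpos.le, ← pow_two, ← Complex.sq_norm_sub_sq_re,
      hA2, ← sq_abs A.re, hre2]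
    ring
  have hsumA : ‖A‖ + |A.re| = xA := by rw [hA2, hre2]; ring
  have hsumB : ‖A‖ - |A.re| = xB := by rw [hA2, hre2]; ring
  have hcv : ∀ η, changeOfVariable xA xB η = (η - A.im / xA) / √(‖A‖ - η * A.im) := fun η => by
    rw [changeOfVariable, sqrt_div_eq_sqrt_mul_div hxA, hA2, him2]
  have htrans : ∀ η a, KeplerArc.IsDirectSymmetric A B η a →
      ∃ b, KeplerArc.IsDirectRectilinear xA xB (changeOfVariable xA xB η) b ∧
        b.elapsedTime = a.elapsedTime := fun η a ha => by
    have h := ha.exists_isDirectRectilinear hre him hpos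
    rwa [hsumA, hsumB, ← hcv] at h
  have hbij := bijOn_changeOfVariable hxB hxBA
  -- The default `0` is given to velocities without an arc; it plays no role for `v < v_E`, where
  -- arcs exist.
  have hTR : ∀ v, ∃ T, ∀ a, KeplerArc.IsDirectRectilinear xA xB v a → a.elapsedTime = T := by
    intro v
    by_cases h : ∃ b, KeplerArc.IsDirectRectilinear xA xB v b
    · obtain ⟨b, hb⟩ := h
      exact ⟨b.elapsedTime, fun a ha => ha.elapsedTime_eq hb hxB hxBA⟩
    · exact ⟨0, fun a ha => (h ⟨a, ha⟩).elim⟩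
  choose TR hTR using hTR
  refine ⟨hbij, contDiffOn_changeOfVariable hxB hxBA, fun η hη => ?_,
    fun η => TR (changeOfVariable xA xB η), fun η => (η ^ 2 - 1) / (2 * (‖A‖ - η * A.im)),
    TR, fun v => v ^ 2 / 2 - 1 / xA, fun η hη => ⟨?_, fun a ha => ⟨?_, ?_⟩⟩,
    fun v hv => ⟨?_, fun a ha => ⟨hTR v a ha, ha.hasEnergy hxA⟩⟩,
    fun _ _ => rfl, fun _ _ => rfl, fun η hη => ⟨rfl, ?_⟩⟩
  · obtain ⟨d, hd0, hd⟩ := exists_hasDerivAt_changeOfVariable hxB hxBA (le_of_lt hη)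
    rwa [hd.deriv]
  · exact KeplerArc.exists_isDirectSymmetric hre0 hre him hpos hη
  · obtain ⟨b, hb, hba⟩ := htrans η a ha
    rw [← hba, hTR _ b hb]
  · have h := ha.2.2.hasEnergy
    rwa [ha.1.1] at h
  -- Existence of the rectilinear arc: write `v = v_A(η)` and transform the symmetric arc of
  -- eccentricity `η`.
  · obtain ⟨η, hη, rfl⟩ := hbij.surjOn hv
    obtain ⟨a, ha⟩ := KeplerArc.exists_isDirectSymmetric hre0 hre him hpos hη
    obtain ⟨b, hb, -⟩ := htrans η a ha
    exact ⟨b, hb⟩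
  · have hD := KeplerArc.norm_sub_mul_im_pos hre0 hpos hη
    have h2 : A.im ^ 2 = xA * xB := by rw [him2, Real.sq_sqrt (by positivity)]
    simp only [hcv]
    rw [div_pow, Real.sq_sqrt hD.le]
    field_simp
    rw [hA2]
    linear_combination (-1 : ℝ) * h2
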